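/- **Conventions.** A locale $X$ is given by a frame of opens (a complete lattice in which finite meets distribute over arbitrary joins, with top element $\top$); a morphism of locales $X\to Y$ is a frame homomorphism in the opposite direction, from the opens of $Y$ to the opens of $X$. An open $a$ of $X$ defines an open sublocale with frame $\{b\mid b\le a\}$, whose inclusion into $X$ corresponds to $b\mapsto b\wedge a$; an open embedding is a morphism isomorphic (over $X$) to such an inclusion. A positive partition on $X$ is a family of continuous functions $f_i\colon X\to[0,\infty)$, $i\in I$, whose sum is everywhere defined, continuous and strictly positive: there is a continuous $s\colon X\to[0,\infty)$ with $\{s>0\}=\top$ and $\{s>q\}=\bigvee_{F\subset I\text{ finite}}\{\sum_{i\in F}f_i>q\}$ for all $q\in\mathbb R$. An open cover $\{U_i\}_{i\in I}$ of $X$ is numerable if there is a positive partition $\{f_i\}_{i\in I}$ on $X$ with $\{f_i>0\}\le U_i$ for all $i$. The category $\mathsf{Loc}$ of locales carries the Grothendieck topology generated by numerable open covers. In a category with a Grothendieck topology, a covering family is a family of morphisms with a common codomain such that the sieve it generates is covering. The Grothendieck topology generated by a collection of families is the smallest Grothendieck topology for which all these families are covering families. A *numerable site* is a category $S$ with a Grothendieck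 topology and a functor $U\colon S\to\mathsf{Loc}$ such that * every open embedding $h\colon Y\to U(\hat Z)$, $\hat Z\in S$, has a cartesian lift: there are a morphism $\hat h\colon\hat Y\to\hat Z$ in $S$ and an isomorphism $e\colon U(\hat Y)\cong Y$ with $h e=U(\hat h)$, such that for every $\hat f\colon\hat X\to\hat Z$ in $S$ and every $g\colon U(\hat X)\to U(\hat Y)$ with $U(\hat h)g=U(\hat f)$ there is a unique $\hat g\colon\hat X\to\hat Y$ with $\hat h\hat g=\hat f$ and $U(\hat g)=g$; * $U$ creates covering families: a family $\{f_i\colon Y_i\to X\}_i$ in $S$ is a covering family in $S$ if and only if $\{U(f_i)\colon U(Y_i)\to U(X)\}_i$ is a covering family in $\mathsf{Loc}$. A family $\{f_i\colon Y_i\to X\}_{i\in I}$ of morphisms of $S$ is *disjoint* if there are pairwise disjoint opens $V_i$ of $U(X)$, $i\in I$, such that each $U(f_i)$ factors through the inclusion of the open sublocale $V_i$. **Theorem (good generation of numerable sites).** If $U\colon S\to\mathsf{Loc}$ is a numerable site, then the Grothendieck topology on $S$ is generated by the covering families with two elements (families indexed by a two-element set) together with the disjoint covering families indexed by a set. -/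

import Mathlib

open CategoryTheory
open scoped NNReal

universe w v u

namespace NumerableSites

section Locales

/-! ### Open sublocales and open embeddings -/

/-- The elements below a fixed element `a` of a frame form a frame. -/
instance frameIic {L : Type w} [Order.Frame L] (a : L) : Order.Frame (Set.Iic a) :=
  Order.Frame.ofMinimalAxioms
    { inf_sSup_le_iSup_inf := by
        intro x s
        rw [← Subtype.coe_le_coe]
        simp only [Set.Iic.coe_inf, Set.Iic.coe_sSup, Set.Iic.coe_iSup]
        rw [inf_sSup_eq]
        refine iSup₂_le ?_
        rintro _ ⟨c, hc, rfl⟩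
        exact le_iSup₂_of_le c hc le_rfl }

/-- The frame homomorphism `b ↦ b ⊓ a` restricting opens to the open `a`. -/
def restrictHom {L : Type w} [Order.Frame L] (a : L) : FrameHom L (Set.Iic a) where
  toFun b := ⟨b ⊓ a, inf_le_right⟩
  map_inf' b c := Subtype.ext (by simpa using inf_inf_distrib_right b c a)
  map_top' := Subtype.ext (by simp)
  map_sSup' s := Subtype.ext (by
    rw [sSup_image]
    simp only [Set.Iic.coe_iSup, sSup_inf_eq])

/-- The open sublocale of the locale `X` given by the open `a`. -/
def openSublocale (X : Locale.{w}) (a : X) : Locale.{w} :=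
  Locale.of (Set.Iic a)

/-- The inclusion of the open sublocale of `X` given by the open `a`. -/
def openInclusion (X : Locale.{w}) (a : X) : openSublocale X a ⟶ X :=
  (Frm.ofHom (restrictHom a)).op

/-- A map of locales is an open embedding if it is isomorphic to the inclusion of an open
sublocale. -/
def IsOpenEmbedding {Y X : Locale.{w}} (h : Y ⟶ X) : Prop :=
  ∃ (a : X) (e : Y ≅ openSublocale X a), e.hom ≫ openInclusion X a = h

/-! ### Positive partitions and numerable open covers -/

/-- Continuous functions from the locale with frame of opens `L` to `[0,∞)`. -/
abbrev NNFunction (L : Type w) [Order.Frame L] : Type w :=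
  FrameHom (TopologicalSpace.Opens ℝ≥0) L

/-- The open `{f > q}`, for a real number `q`. -/
def NNFunction.gt {L : Type w} [Order.Frame L] (f : NNFunction L) (q : ℝ) : L :=
  f ⟨{x : ℝ≥0 | q < (x : ℝ)}, isOpen_lt continuous_const NNReal.continuous_coe⟩

/-- The open `{∑ i, f i > q}`, where the (possibly infinite, a priori extended real-valued) sum
is the supremum of its finite partial sums. It is the union, over all finite sets `F` of indices
and all real numbers `r i` with `∑ i ∈ F, r i > q`, of the opens
`⋂ i ∈ F, {f i > r i}`. -/
def sumGt {L : Type w} [Order.Frame L] {ι : Type w} (f : ι → NNFunction L) (q : ℝ) : L :=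
  ⨆ (F : Finset ι) (r : ι → ℝ) (_ : q < ∑ i ∈ F, r i), F.inf fun i => (f i).gt (r i)

/-- A family of continuous functions `f i : X → [0,∞)` is a positive partition if its sum is
everywhere defined, continuous and strictly positive: there is a continuous function
`s : X → [0,∞)` such that `s > 0` on all of `X` and `s` is the sum of the `f i`
(a function is determined by the opens `{s > q}`). -/
def IsPositivePartition {L : Type w} [Order.Frame L] {ι : Type w} (f : ι → NNFunction L) : Prop :=
  ∃ s : NNFunction L, s.gt 0 = ⊤ ∧ ∀ q : ℝ, s.gt q = sumGt f q

/-- A family of opens is a numerable open cover if it is a cover that admits a compatible positive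
partition, i.e., a positive partition `f` such that `{f i > 0} ⊆ U i` for all `i`. -/
def IsNumerableCover {L : Type w} [Order.Frame L] {ι : Type w} (U : ι → L) : Prop :=
  (⨆ i, U i) = ⊤ ∧ ∃ f : ι → NNFunction L, IsPositivePartition f ∧ ∀ i, (f i).gt 0 ≤ U i

/-- The families of inclusions of open sublocales that form numerable open covers. -/
def numerableCovers : Precoverage Locale.{w} where
  coverings X :=
    {R | ∃ (ι : Type w) (U : ι → X), IsNumerableCover U ∧
      R = Presieve.ofArrows (fun i => openSublocale X (U i)) (fun i => openInclusion X (U i))}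

/-- The Grothendieck topology on the category of locales generated by numerable open covers. -/
def numerableTopology : GrothendieckTopology Locale.{w} :=
  numerableCovers.toGrothendieck

end Locales

section Sites

/-! ### Numerable sites -/

/-- A family of morphisms with codomain `X` is a covering family if the smallest sieve containing
it is a covering sieve. -/
def IsCoveringFamily {C : Type*} [Category* C] (J : GrothendieckTopology C) {X : C} {ι : Type*}
    (Y : ι → C) (f : ∀ i, Y i ⟶ X) : Prop :=
  Sieve.generate (Presieve.ofArrows Y f) ∈ J X

/-- A numerable site: a category `S` with a Grothendieck topology `J` and a functor `U` to locales
that admits cartesian lifts of open embeddings and creates covering families.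

In `exists_lift`, the lift `g` of `h` lies over `h` up to an isomorphism `e` of domains, i.e., it
is not required that `U.obj Y'` and `Y` are equal.
In `creates`, every family of morphisms of `S` with codomain `X` can be indexed by a type in
`Type (max u v)`, up to repetitions. -/
structure IsNumerableSite {S : Type u} [Category.{v} S] (J : GrothendieckTopology S)
    (U : S ⥤ Locale.{w}) : Prop where
  exists_lift : ∀ (Z : S) (Y : Locale.{w}) (h : Y ⟶ U.obj Z), IsOpenEmbedding h →
    ∃ (Y' : S) (g : Y' ⟶ Z) (e : U.obj Y' ≅ Y),
      e.hom ≫ h = U.map g ∧ U.IsStronglyCartesian (U.map g) g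
  creates : ∀ (X : S) (ι : Type (max u v)) (Y : ι → S) (f : ∀ i, Y i ⟶ X),
    IsCoveringFamily numerableTopology (fun i => U.obj (Y i)) (fun i => U.map (f i)) ↔
      IsCoveringFamily J Y f

/-- A family of morphisms of `S` is disjoint if its image in locales factors through pairwise
disjoint open inclusions. -/
def IsDisjointFamily {S : Type u} [Category.{v} S] (U : S ⥤ Locale.{w}) {X : S} {ι : Type w}
    (Y : ι → S) (f : ∀ i, Y i ⟶ X) : Prop :=
  ∃ V : ι → U.obj X, Pairwise (fun i j => Disjoint (V i) (V j)) ∧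
    ∀ i, ∃ k : U.obj (Y i) ⟶ openSublocale (U.obj X) (V i),
      k ≫ openInclusion (U.obj X) (V i) = U.map (f i)

/-- The covering families with two elements and the disjoint covering families indexed by a set
(i.e., a type in the universe of the underlying types of locales). -/
def twoElementOrDisjointCovers {S : Type u} [Category.{v} S] (J : GrothendieckTopology S)
    (U : S ⥤ Locale.{w}) : Precoverage S where
  coverings X :=
    {R | (∃ (Y : Fin 2 → S) (f : ∀ i, Y i ⟶ X), IsCoveringFamily J Y f ∧
            R = Presieve.ofArrows Y f) ∨
         (∃ (ι : Type w) (Y : ι → S) (f : ∀ i, Y i ⟶ X), IsCoveringFamily J Y f ∧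
            IsDisjointFamily U Y f ∧ R = Presieve.ofArrows Y f)}

end Sites

end NumerableSites

/-! The generating families are covering by definition, so one inclusion is immediate. For the
other, let `K` be the generated topology. The core is that numerable open covers are `K`-covering
(`openSieve_mem`). Being covered by a given sieve is a property of opens that passes to smaller
opens, to disjoint joins, and from `{g < q}`, `{g > p}` with `p < q` to the whole.
`IsStripLocal.top` shows that any such property holding on all `{f i > 0}` of a positive partition
holds on `⊤`.

Splitting along `1 + cos(πg)` gives two opens, each a disjoint union of pieces where `g` is bounded
(`IsStripLocal.of_lt_nat`). So one may assume that the sum is `< n` and that `sup f i > ρ > 0`. Take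
`N > 2n/ρ` disjoint intervals between `ρ/2` and `ρ`. If every interval contained a value of some `f
i`, then `N` distinct `f i` would exceed `ρ/2`, and the sum would exceed `n`. So `N` splittings
leave only regions where no `f i` is near the midpoint `c` of one interval. There every `{f i > c}`
is complemented, and the region is the disjoint union of pieces indexed by the finite set of `i`
with `f i > c`. This set is nonempty as `c ≤ ρ`, so each piece lies in some `{f i > 0}`.

To pass from opens to all covering families, `inducedLocaleTopology` transfers `K` to a topology on
locales that contains the numerable one. Hence a `J`-covering sieve, `K`-locally, contains a
morphism whose underlying map has a section; taken twice, it is a two-element covering family. -/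

namespace NumerableSites

/-! ### Continuous functions from scales of opens -/

section Scales

open TopologicalSpace

variable {L : Type w} [Order.Frame L]

/-- The open `{g < q}`, for a real number `q`. -/
def NNFunction.lt (g : NNFunction L) (q : ℝ) : L :=
  g ⟨{x : ℝ≥0 | (x : ℝ) < q}, isOpen_lt NNReal.continuous_coe continuous_const⟩

/-- A descending scale in a frame: the family of opens `{g > q}` of a bounded continuous
real-valued function `g`. -/
structure IsScale (G : ℝ → L) : Prop where
  anti : Antitone G
  le_iSup : ∀ q, G q ≤ ⨆ r > q, G r
  compl_sup : ∀ p q, p < q → (G q)ᶜ ⊔ G p = ⊤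
  exists_top : ∃ A, G A = ⊤
  exists_bot : ∃ B, G B = ⊥

/-- The open `{g < q}` of the function with scale `G`. -/
def scaleLt (G : ℝ → L) (q : ℝ) : L := ⨆ r < q, (G r)ᶜ

/-- The inverse image of an open subset of `ℝ` under the function with scale `G`. -/
def scalePreimage (G : ℝ → L) (O : Opens ℝ) : L :=
  ⨆ (p : ℝ) (q : ℝ) (_ : Set.Icc p q ⊆ O), G p ⊓ scaleLt G q

variable {G : ℝ → L}

lemma scaleLt_mono : Monotone (scaleLt G) := fun _ _ h =>
  iSup₂_le fun r hr => le_iSup₂_of_le r (hr.trans_le h) le_rfl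

lemma scaleLt_le_iSup (q : ℝ) : scaleLt G q ≤ ⨆ r < q, scaleLt G r :=
  iSup₂_le fun r hr => by
    obtain ⟨t, h1, h2⟩ := exists_between hr
    exact le_iSup₂_of_le t h2 (le_iSup₂_of_le r h1 le_rfl)

lemma IsScale.scaleLt_le_compl (hG : IsScale G) (q : ℝ) : scaleLt G q ≤ (G q)ᶜ :=
  iSup₂_le fun _ hr => compl_le_compl (hG.anti hr.le)

lemma IsScale.inf_scaleLt (hG : IsScale G) {p q : ℝ} (h : q ≤ p) : G p ⊓ scaleLt G q = ⊥ :=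
  le_bot_iff.1 <| (inf_le_inf (hG.anti h) (hG.scaleLt_le_compl q)).trans (inf_compl_self _).le

lemma IsScale.sup_scaleLt (hG : IsScale G) {p q : ℝ} (h : p < q) : G p ⊔ scaleLt G q = ⊤ := by
  obtain ⟨t, h1, h2⟩ := exists_between h
  rw [eq_top_iff, ← hG.compl_sup p t h1, sup_comm]
  exact sup_le_sup le_rfl (le_iSup₂_of_le t h2 le_rfl)

lemma le_scalePreimage {O : Opens ℝ} {p q : ℝ} (h : Set.Icc p q ⊆ O) :
    G p ⊓ scaleLt G q ≤ scalePreimage G O :=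
  le_iSup_of_le p (le_iSup₂_of_le q h le_rfl)

lemma scalePreimage_mono : Monotone (scalePreimage G) := fun _ _ h =>
  iSup_le fun _ => iSup₂_le fun _ hq => le_scalePreimage (hq.trans h)

/-- Compactness of `[p, q]` by real induction on `t`: the good `t` form a closed set because
`scaleLt G t` is the join of its values below `t`, and a ball around `t` inside one member of `s`
carries the inequality past `t`. -/
lemma IsScale.inf_scaleLt_le_iSup (hG : IsScale G) (s : Set (Opens ℝ)) {p q : ℝ}
    (h : Set.Icc p q ⊆ (sSup s : Opens ℝ)) :
    G p ⊓ scaleLt G q ≤ ⨆ O ∈ s, scalePreimage G O := by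
  set Y := ⨆ O ∈ s, scalePreimage G O
  rcases lt_or_ge q p with hqp | hpq
  · simp [hG.inf_scaleLt hqp.le]
  let T : Set ℝ := {t | G p ⊓ scaleLt G t ≤ Y}
  have hclosed : IsClosed (T ∩ Set.Icc p q) := by
    have : IsClosed T := by
      rw [← isOpen_compl_iff, isOpen_iff_mem_nhds]
      intro t ht
      by_contra hn
      refine ht ?_
      refine (inf_le_inf le_rfl (scaleLt_le_iSup t)).trans ?_
      simp only [inf_iSup_eq]
      refine iSup₂_le fun r hr => ?_
      by_contra hr'
      refine hn (Filter.mem_of_superset (Ioi_mem_nhds hr) fun x (hx : r < x) hxT => hr' ?_)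
      exact (inf_le_inf le_rfl (scaleLt_mono hx.le)).trans hxT
    exact this.inter isClosed_Icc
  refine (hclosed.Icc_subset_of_forall_exists_gt (a := p) (b := q) ?_ ?_)
    (Set.right_mem_Icc.2 hpq)
  · exact (hG.inf_scaleLt le_rfl).trans_le bot_le
  · rintro t ⟨htT, htI⟩ y (hty : t < y)
    have htm := h (Set.Ico_subset_Icc_self htI)
    rw [Opens.coe_sSup, Set.mem_iUnion₂] at htm
    obtain ⟨O, hO, htO⟩ := htm
    obtain ⟨ε, hε, hb⟩ := Metric.isOpen_iff.1 O.isOpen t htO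
    refine ⟨min y (t + ε / 2), ?_, lt_min hty (by linarith), min_le_left _ _⟩
    have hstep : G (t - ε / 2) ⊓ scaleLt G (t + ε / 2) ≤ Y := by
      refine le_trans (le_scalePreimage (O := O) fun x hx => hb ?_) (le_iSup₂_of_le O hO le_rfl)
      rw [Metric.mem_ball, Real.dist_eq, abs_lt]
      constructor <;> linarith [hx.1, hx.2]
    calc G p ⊓ scaleLt G (min y (t + ε / 2))
        ≤ (G p ⊓ scaleLt G (t + ε / 2)) ⊓ (G (t - ε / 2) ⊔ scaleLt G t) := by
          rw [hG.sup_scaleLt (by linarith), inf_top_eq]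
          exact inf_le_inf le_rfl (scaleLt_mono (min_le_right _ _))
      _ ≤ Y := by
          rw [inf_sup_left]
          refine sup_le (le_trans (le_inf inf_le_right ?_) hstep)
            (le_trans (inf_le_inf inf_le_left le_rfl) htT)
          exact inf_le_left.trans inf_le_right

/-- The frame homomorphism given by a scale. -/
def IsScale.frameHom (hG : IsScale G) : FrameHom (Opens ℝ) L where
  toFun := scalePreimage G
  map_inf' O O' := by
    refine le_antisymm (le_inf (scalePreimage_mono inf_le_left) (scalePreimage_mono inf_le_right)) ?_
    simp only [scalePreimage, iSup_inf_eq, inf_iSup_eq]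
    refine iSup_le fun p' => iSup₂_le fun q' h' => iSup_le fun p => iSup₂_le fun q h => ?_
    refine le_trans ?_ (le_scalePreimage (p := max p p') (q := min q q') ?_)
    · rcases le_total p p' with hp | hp <;> rcases le_total q q' with hq | hq <;>
        simp only [hp, hq, max_eq_left, max_eq_right, min_eq_left, min_eq_right] <;>
        refine le_inf ?_ ?_
      all_goals
        first
        | exact inf_le_left.trans inf_le_left
        | exact inf_le_left.trans inf_le_right
        | exact inf_le_right.trans inf_le_left
        | exact inf_le_right.trans inf_le_right
    · rw [← Set.Icc_inter_Icc]
      exact Set.inter_subset_inter h h'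
  map_top' := by
    obtain ⟨A, hA⟩ := hG.exists_top
    obtain ⟨B, hB⟩ := hG.exists_bot
    refine top_le_iff.1 (le_trans ?_ (le_scalePreimage (p := A) (q := B + 1) (Set.subset_univ _)))
    rw [hA, top_inf_eq]
    refine le_iSup₂_of_le B (by linarith) ?_
    simp [hB]
  map_sSup' s := by
    rw [sSup_image]
    refine le_antisymm ?_ (iSup₂_le fun O hO => scalePreimage_mono (le_sSup hO))
    exact iSup_le fun p => iSup₂_le fun q h => hG.inf_scaleLt_le_iSup s h

/-- The positive part of the function given by a scale. -/
def IsScale.toNNFunction (hG : IsScale G) : NNFunction L :=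
  hG.frameHom.comp (Opens.comap ⟨Real.toNNReal, continuous_real_toNNReal⟩)

lemma IsScale.toNNFunction_gt (hG : IsScale G) {q : ℝ} (hq : 0 ≤ q) :
    hG.toNNFunction.gt q = G q := by
  refine le_antisymm (iSup_le fun p => iSup₂_le fun r h => ?_) ?_
  · rcases lt_or_ge r p with hrp | hpr
    · simp [hG.inf_scaleLt hrp.le]
    · refine inf_le_left.trans (hG.anti ?_)
      have hp : q < (p.toNNReal : ℝ) := h (Set.left_mem_Icc.2 hpr)
      rcases le_total 0 p with h0 | h0
      · rw [Real.coe_toNNReal _ h0] at hp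
        exact hp.le
      · rw [Real.toNNReal_of_nonpos h0] at hp
        exact absurd hp (not_lt.2 hq)
  · refine (hG.le_iSup q).trans (iSup₂_le fun r hr => ?_)
    obtain ⟨B, hB⟩ := hG.exists_bot
    have hl : scaleLt G (B + 1) = ⊤ :=
      top_le_iff.1 (le_iSup₂_of_le B (by linarith) (by simp [hB]))
    rw [← inf_top_eq (G r), ← hl]
    refine le_scalePreimage fun x hx => ?_
    change q < (x.toNNReal : ℝ)
    rw [Real.coe_toNNReal _ (hq.trans (hr.le.trans hx.1))]
    exact lt_of_lt_of_le hr hx.1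

/-- Only an inequality: `(G q)ᶜ` is the interior of `{g ≤ q}`, which can be larger than `{g < q}`.
-/
lemma IsScale.toNNFunction_lt_le (hG : IsScale G) (q : ℝ) :
    hG.toNNFunction.lt q ≤ (G q)ᶜ := by
  refine iSup_le fun p => iSup₂_le fun r h => ?_
  rcases lt_or_ge r p with hrp | hpr
  · simp [hG.inf_scaleLt hrp.le]
  · refine inf_le_right.trans ((scaleLt_mono ?_).trans (hG.scaleLt_le_compl q))
    have hr : (r.toNNReal : ℝ) < q := h (Set.right_mem_Icc.2 hpr)
    exact (Real.le_coe_toNNReal r).trans hr.le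

end Scales

/-! ### Functions to `[0,∞)`, strip-local properties and reduction to bounded functions -/

section Functions

open TopologicalSpace

variable {L : Type w} [Order.Frame L]

/-- The composition of `f : X → [0,∞)` with a continuous function `[0,∞) → [0,∞)`. -/
def NNFunction.postcomp (f : NNFunction L) (φ : C(ℝ≥0, ℝ≥0)) : NNFunction L :=
  f.comp (Opens.comap φ)

lemma NNFunction.mono (g : NNFunction L) {O O' : Opens ℝ≥0} (h : O ≤ O') : g O ≤ g O' :=
  OrderHomClass.mono g h

lemma NNFunction.inf_le_bot (g : NNFunction L) {O O' : Opens ℝ≥0} (h : ∀ x ∈ O, x ∉ O') :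
    g O ⊓ g O' ≤ ⊥ := by
  rw [← map_inf, ← map_bot g]
  exact g.mono fun x hx => h x hx.1 hx.2

lemma NNFunction.gt_anti (g : NNFunction L) : Antitone g.gt := fun _ _ h =>
  g.mono fun _ hx => lt_of_le_of_lt h hx

lemma NNFunction.gt_eq_top (g : NNFunction L) {q : ℝ} (hq : q < 0) : g.gt q = ⊤ := by
  rw [← map_top g]
  exact congrArg g (Opens.ext (Set.eq_univ_of_forall fun x => hq.trans_le x.coe_nonneg))

lemma NNFunction.gt_inf_lt (g : NNFunction L) {p q : ℝ} (h : q ≤ p) : g.gt p ⊓ g.lt q ≤ ⊥ :=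
  g.inf_le_bot fun _ hx hx' => (h.trans_lt (lt_trans hx hx')).false

lemma NNFunction.lt_sup_gt (g : NNFunction L) {p q : ℝ} (h : p < q) : g.lt q ⊔ g.gt p = ⊤ := by
  rw [NNFunction.lt, NNFunction.gt, ← map_sup, ← map_top g]
  refine congrArg g (Opens.ext (Set.eq_univ_of_forall fun x => ?_))
  exact (lt_or_ge (x : ℝ) q).imp id fun hx => h.trans_le hx

lemma NNFunction.compl_gt_sup_gt (g : NNFunction L) {p q : ℝ} (h : p < q) :
    (g.gt q)ᶜ ⊔ g.gt p = ⊤ := by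
  rw [eq_top_iff, ← g.lt_sup_gt h]
  refine sup_le_sup (le_compl_iff_disjoint_left.2 ?_) le_rfl
  exact disjoint_iff_inf_le.2 (g.gt_inf_lt le_rfl)

lemma NNFunction.gt_le_iSup (g : NNFunction L) (q : ℝ) : g.gt q ≤ ⨆ r > q, g.gt r := by
  simp only [NNFunction.gt, ← map_iSup]
  refine g.mono fun x hx => ?_
  obtain ⟨r, h1, h2⟩ := exists_between (show q < (x : ℝ) from hx)
  simp only [Opens.mem_iSup]
  exact ⟨r, h1, h2⟩

/-- The reciprocal of a strictly positive function. -/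
def NNFunction.inv (g : NNFunction L) (hg : g.gt 0 = ⊤) : NNFunction L where
  toFun O := g ⟨{x | 0 < x ∧ x⁻¹ ∈ O}, by
    have hc : ContinuousOn (fun x : ℝ≥0 => x⁻¹) {x | 0 < x} :=
      continuousOn_inv₀.mono fun x hx => (ne_of_gt hx : x ≠ 0)
    exact hc.isOpen_inter_preimage (isOpen_lt continuous_const continuous_id) O.isOpen⟩
  map_inf' O O' := by
    rw [← map_inf]
    refine congrArg g (Opens.ext (Set.ext fun x => ?_))
    exact ⟨fun h => ⟨⟨h.1, h.2.1⟩, h.1, h.2.2⟩, fun h => ⟨h.1.1, h.1.2, h.2.2⟩⟩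
  map_top' := by
    rw [← hg]
    refine congrArg g (Opens.ext (Set.ext fun x => ?_))
    exact ⟨fun h => NNReal.coe_pos.2 h.1, fun h => ⟨NNReal.coe_pos.1 h, trivial⟩⟩
  map_sSup' s := by
    rw [sSup_image, ← map_iSup₂ g]
    refine congrArg g (Opens.ext (Set.ext fun x => ?_))
    simp only [SetLike.mem_coe, Opens.mem_iSup]
    constructor
    · rintro ⟨h0, hx⟩
      obtain ⟨O, hO, hxO⟩ := Opens.mem_sSup.1 hx
      exact ⟨O, hO, h0, hxO⟩
    · rintro ⟨O, hO, h0, hxO⟩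
      exact ⟨h0, Opens.mem_sSup.2 ⟨O, hO, hxO⟩⟩

lemma NNFunction.inv_lt_le (g : NNFunction L) (hg : g.gt 0 = ⊤) {q : ℝ} (hq : 0 < q) :
    (g.inv hg).lt q ≤ g.gt q⁻¹ :=
  g.mono fun x hx => by
    have h1 : (x : ℝ)⁻¹ < q := by simpa using hx.2
    exact (inv_lt_comm₀ (NNReal.coe_pos.2 hx.1) hq).1 h1

/-- A property of opens that is inherited by smaller opens and is local for disjoint covers
and for the covers `{g < q}, {g > p}` with `p < q`, given by a function `g`. -/
structure IsStripLocal (P : L → Prop) : Prop where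
  mono : ∀ {a b : L}, a ≤ b → P b → P a
  iSup : ∀ {κ : Type w} (a : κ → L), Pairwise (fun i j => Disjoint (a i) (a j)) →
    (∀ k, P (a k)) → P (⨆ k, a k)
  split : ∀ {a : L} (g : NNFunction L) {p q : ℝ}, p < q → P (a ⊓ g.lt q) → P (a ⊓ g.gt p) → P a

variable {P : L → Prop}

lemma IsStripLocal.of_le_bot (hP : IsStripLocal P) {a : L} (h : a ≤ ⊥) : P a :=
  hP.mono (h.trans bot_le) (hP.iSup (fun i : PEmpty => i.elim) (fun i => i.elim) fun i => i.elim)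

/-- Without the points `c + 2n`, the half-line falls into the disjoint intervals `(c + 2n, c + 2n +
2)`. Since `c ≤ 0`, these miss nothing near `0`, and the `n`-th one lies below `2n + 2`. -/
lemma IsStripLocal.of_intervals (hP : IsStripLocal P) {a : L} (g : NNFunction L)
    (h : ∀ n : ℕ, P (a ⊓ g.lt n)) (c : ℝ) (hc : c ≤ 0) (O : Opens ℝ≥0)
    (hO : ∀ x ∈ O, ∀ n : ℕ, (x : ℝ) ≠ c + 2 * n) : P (a ⊓ g O) := by
  let I : ULift.{w} ℕ → Opens ℝ≥0 := fun n =>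
    ⟨{x : ℝ≥0 | c + 2 * n.down < (x : ℝ)}, isOpen_lt continuous_const NNReal.continuous_coe⟩ ⊓
    ⟨{x : ℝ≥0 | (x : ℝ) < c + 2 * n.down + 2}, isOpen_lt NNReal.continuous_coe continuous_const⟩
  have hle : a ⊓ g O ≤ ⨆ n, a ⊓ g (I n) := by
    rw [← inf_iSup_eq, ← map_iSup]
    refine inf_le_inf le_rfl (g.mono fun x hx => ?_)
    have h0 : 0 ≤ ((x : ℝ) - c) / 2 := by linarith [x.coe_nonneg]
    have h1 := Nat.floor_le h0
    have h2 := Nat.lt_floor_add_one (((x : ℝ) - c) / 2)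
    refine Opens.mem_iSup.2 ⟨⟨⌊((x : ℝ) - c) / 2⌋₊⟩, ?_, ?_⟩
    · exact lt_of_le_of_ne (by dsimp only; linarith) (hO x hx _).symm
    · change (x : ℝ) < c + 2 * (⌊((x : ℝ) - c) / 2⌋₊ : ℝ) + 2
      linarith
  refine hP.mono hle (hP.iSup _ ?_ ?_)
  · rintro ⟨m⟩ ⟨n⟩ hmn
    refine disjoint_iff_inf_le.2 ((inf_le_inf inf_le_right inf_le_right).trans
      (g.inf_le_bot fun x hx hx' => hmn ?_))
    have h1 : c + 2 * (m : ℝ) < x := hx.1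
    have h2 : (x : ℝ) < c + 2 * m + 2 := hx.2
    have h3 : c + 2 * (n : ℝ) < x := hx'.1
    have h4 : (x : ℝ) < c + 2 * n + 2 := hx'.2
    have h5 : (m : ℝ) < (n + 1 : ℕ) := by push_cast; linarith
    have h6 : (n : ℝ) < (m + 1 : ℕ) := by push_cast; linarith
    have h7 := Nat.cast_lt.1 h5
    have h8 := Nat.cast_lt.1 h6
    exact congrArg ULift.up (by omega)
  · rintro ⟨n⟩
    refine hP.mono (inf_le_inf le_rfl (g.mono fun x hx => ?_)) (h (2 * n + 2))
    have h2 : (x : ℝ) < c + 2 * n + 2 := hx.2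
    change (x : ℝ) < ((2 * n + 2 : ℕ) : ℝ)
    push_cast
    linarith

lemma IsStripLocal.of_lt_nat (hP : IsStripLocal P) {a : L} (g : NNFunction L)
    (h : ∀ n : ℕ, P (a ⊓ g.lt n)) : P a := by
  -- `ψ` is `2` at even and `0` at odd integers, so `{ψ < 3/2}` avoids the former and `{ψ > 1/2}`
  -- the latter.
  let ψ : C(ℝ≥0, ℝ≥0) := ⟨fun x => (1 + Real.cos (x * Real.pi)).toNNReal, by fun_prop⟩
  have hψ : ∀ x : ℝ≥0, ((ψ x : ℝ≥0) : ℝ) = 1 + Real.cos (x * Real.pi) := fun x =>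
    Real.coe_toNNReal _ (by linarith [Real.neg_one_le_cos (x * Real.pi)])
  refine hP.split (g.postcomp ψ) (show (1 / 2 : ℝ) < 3 / 2 by norm_num) ?_ ?_
  · refine hP.of_intervals g h 0 le_rfl _ fun x hx n hn => ?_
    have hx' : ((ψ x : ℝ≥0) : ℝ) < 3 / 2 := hx
    rw [hψ, hn, show (0 + 2 * (n : ℝ)) * Real.pi = n * (2 * Real.pi) by ring,
      Real.cos_nat_mul_two_pi] at hx'
    norm_num at hx'
  · refine hP.of_intervals g h (-1) (by norm_num) _ fun x hx n hn => ?_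
    have hx' : (1 / 2 : ℝ) < (ψ x : ℝ≥0) := hx
    rw [hψ, hn, show (-1 + 2 * (n : ℝ)) * Real.pi = n * (2 * Real.pi) - Real.pi by ring,
      Real.cos_nat_mul_two_pi_sub_pi] at hx'
    norm_num at hx'

end Functions

/-! ### Local finiteness of positive partitions, suprema and level sets -/

section Partitions

open TopologicalSpace

variable {L : Type w} [Order.Frame L] {ι : Type w} {f : ι → NNFunction L}

lemma inf_gt_le_sumGt {F : Finset ι} {r : ι → ℝ} {q : ℝ} (h : q < ∑ i ∈ F, r i) :
    (F.inf fun i => (f i).gt (r i)) ≤ sumGt f q :=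
  le_iSup_of_le F (le_iSup₂_of_le r h le_rfl)

lemma IsPositivePartition.iSup_gt_zero (hf : IsPositivePartition f) : ⨆ i, (f i).gt 0 = ⊤ := by
  obtain ⟨s, h0, hs⟩ := hf
  rw [eq_top_iff, ← h0, hs]
  refine iSup_le fun F => iSup₂_le fun r hr => ?_
  obtain ⟨i, hi, hri⟩ : ∃ i ∈ F, 0 < r i := by
    by_contra! h
    exact absurd (Finset.sum_nonpos h) (not_le.2 hr)
  exact le_iSup_of_le i ((Finset.inf_le hi).trans ((f i).gt_anti hri.le))

/-- Locally, all but finitely many members of a positive partition are bounded by `ε`. -/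
lemma IsPositivePartition.iSup_compl_gt (hf : IsPositivePartition f) {ε : ℝ} (hε : 0 < ε) :
    ⨆ F : Finset ι, (⨆ j ∉ F, (f j).gt ε)ᶜ = ⊤ := by
  classical
  obtain ⟨s, -, hs⟩ := hf
  -- Where `s` lies in `(a, a + ε)` and the partial sum over `F` exceeds `a`, one further `f j > ε`
  -- would push `s` above `a + ε`.
  have hcov : (⊤ : L) ≤ ⨆ a : ℝ, s.gt a ⊓ s.lt (a + ε) := by
    simp only [NNFunction.gt, NNFunction.lt, ← map_inf, ← map_iSup, ← map_top s]
    refine s.mono fun x _ => Opens.mem_iSup.2 ⟨(x : ℝ) - ε / 2, ?_, ?_⟩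
    · change (x : ℝ) - ε / 2 < x
      linarith
    · change (x : ℝ) < x - ε / 2 + ε
      linarith
  refine top_le_iff.1 (hcov.trans (iSup_le fun a => ?_))
  rw [hs, sumGt]
  simp only [iSup_inf_eq]
  refine iSup_le fun F => iSup₂_le fun r hr => le_iSup_of_le F ?_
  rw [le_compl_iff_disjoint_right, disjoint_iff_inf_le]
  simp only [inf_iSup_eq]
  refine iSup₂_le fun j hj => le_trans ?_ (s.gt_inf_lt (le_refl (a + ε)))
  refine le_inf ?_ (inf_le_left.trans inf_le_right)
  rw [hs]
  refine le_trans ?_ (inf_gt_le_sumGt (F := insert j F) (r := Function.update r j ε) ?_)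
  · refine Finset.le_inf fun i hi => ?_
    rcases eq_or_ne i j with rfl | hij
    · simp
    · rw [Function.update_of_ne hij]
      exact inf_le_left.trans
        (inf_le_left.trans (Finset.inf_le ((Finset.mem_insert.1 hi).resolve_left hij)))
  · rw [Finset.sum_insert hj, Finset.sum_update_of_notMem hj, Function.update_self]
    linarith

lemma compl_iSup_sup_eq_top {κ : Type*} (a : κ → L) (b : L) (F : Finset κ)
    (h : ∀ i, (a i)ᶜ ⊔ b = ⊤) : (⨆ i ∈ F, a i)ᶜ ⊔ b = ⊤ := by
  classical
  induction F using Finset.induction_on with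
  | empty => simp
  | insert j F _ ih => rw [Finset.iSup_insert, compl_sup, sup_inf_right, h, ih, inf_top_eq]

/-- Continuity of the supremum from above is the point. As `φ 0 = 0`, a value `φ (f i) > q > 0`
forces `f i > δ`, which locally happens only for `i` in a finite set, and finite suprema cause no
trouble. -/
lemma IsPositivePartition.isScale_iSup (hf : IsPositivePartition f) (φ : C(ℝ≥0, ℝ≥0))
    (h0 : φ 0 = 0) (h1 : ∀ x, φ x ≤ 1) :
    IsScale fun t => ⨆ i, ((f i).postcomp φ).gt t where
  anti _ _ h := iSup_mono fun i => NNFunction.gt_anti _ h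
  le_iSup q := iSup_le fun i => (NNFunction.gt_le_iSup _ q).trans
    (iSup₂_mono fun r _ => le_iSup (fun i => ((f i).postcomp φ).gt r) i)
  exists_top := ⟨-1, by
    rw [eq_top_iff, ← hf.iSup_gt_zero]
    exact iSup_mono fun i => by
      rw [NNFunction.gt_eq_top (_ : NNFunction L) (by norm_num : (-1 : ℝ) < 0)]
      exact le_top⟩
  exists_bot := ⟨1, by
    refine le_bot_iff.1 (iSup_le fun i => ?_)
    rw [← map_bot (f i)]
    refine (f i).mono fun x hx => ?_
    have hx' : (1 : ℝ) < (φ x : ℝ≥0) := hx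
    exact absurd (h1 x) (not_le.2 (by exact_mod_cast hx'))⟩
  compl_sup p q hpq := by
    rcases lt_or_ge p 0 with hp | hp
    · rw [eq_top_iff, ← hf.iSup_gt_zero]
      refine le_trans (iSup_mono fun i => ?_) le_sup_right
      rw [NNFunction.gt_eq_top _ hp]
      exact le_top
    obtain ⟨δ, hδ, hφ⟩ : ∃ δ : ℝ, 0 < δ ∧ ∀ x : ℝ≥0, q < (φ x : ℝ≥0) → δ < x := by
      have hq : (φ 0 : ℝ) < q := by rw [h0]; exact lt_of_le_of_lt hp hpq
      obtain ⟨δ, hδ, h⟩ := Metric.eventually_nhds_iff.1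
        ((NNReal.continuous_coe.comp φ.continuous).continuousAt.eventually_lt
          continuousAt_const hq)
      refine ⟨δ / 2, half_pos hδ, fun x hx => ?_⟩
      by_contra hn
      refine (lt_asymm hx) (h (y := x) ?_)
      rw [NNReal.dist_eq, NNReal.coe_zero, sub_zero, abs_of_nonneg x.coe_nonneg]
      linarith
    rw [eq_top_iff, ← hf.iSup_compl_gt hδ]
    refine iSup_le fun F => ?_
    have hfin := compl_iSup_sup_eq_top (fun i => ((f i).postcomp φ).gt q)
      (⨆ i, ((f i).postcomp φ).gt p) F fun i => by
        rw [eq_top_iff, ← ((f i).postcomp φ).compl_gt_sup_gt hpq]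
        exact sup_le_sup le_rfl (le_iSup (fun i => ((f i).postcomp φ).gt p) i)
    rw [← inf_top_eq (⨆ j ∉ F, (f j).gt δ)ᶜ, ← hfin, inf_sup_left]
    refine sup_le_sup ?_ inf_le_right
    rw [← compl_sup]
    refine compl_le_compl (iSup_le fun i => ?_)
    by_cases hi : i ∈ F
    · exact le_sup_of_le_right (le_iSup₂_of_le i hi le_rfl)
    · exact le_sup_of_le_left (le_iSup₂_of_le i hi ((f i).mono fun x hx => hφ x hx))

/-- The open on which precisely the members of the family with index in `F` exceed `c`. -/
def levelOpen (f : ι → NNFunction L) (c : ℝ) (F : Finset ι) : L :=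
  (F.inf fun i => (f i).gt c) ⊓ (⨆ j ∉ F, (f j).gt c)ᶜ

lemma levelOpen_disjoint (c : ℝ) :
    Pairwise fun F F' : Finset ι => Disjoint (levelOpen f c F) (levelOpen f c F') := by
  have key : ∀ (F F' : Finset ι), ∀ i ∈ F, i ∉ F' →
      Disjoint (levelOpen f c F) (levelOpen f c F') := fun F F' i hi hi' =>
    disjoint_compl_right.mono (inf_le_left.trans (Finset.inf_le hi))
      (inf_le_right.trans
        (compl_le_compl (le_iSup₂_of_le (f := fun j _ => (f j).gt c) i hi' le_rfl)))
  intro F F' hne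
  by_contra hd
  refine hne (Finset.ext fun i => ⟨fun hi => ?_, fun hi => ?_⟩)
  · by_contra hi'
    exact hd (key F F' i hi hi')
  · by_contra hi'
    exact hd (key F' F i hi hi').symm

/-- Locally only finitely many indices can exceed `c`, and over `C` these are decided one at a time.
In `key`, members of `A` exceed `c`, those of `B` are undecided, and all others do not exceed `c`.
-/
lemma IsPositivePartition.le_iSup_levelOpen (hf : IsPositivePartition f) {c : ℝ} (hc : 0 < c)
    {C : L} (hC : ∀ i, C ≤ (f i).gt c ⊔ ((f i).gt c)ᶜ) : C ≤ ⨆ F, levelOpen f c F := by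
  classical
  have key : ∀ B A : Finset ι, C ⊓ ((A.inf fun i => (f i).gt c) ⊓
      (⨆ j ∉ A ∪ B, (f j).gt c)ᶜ) ≤ ⨆ F, levelOpen f c F := by
    intro B
    induction B using Finset.induction_on with
    | empty =>
      intro A
      rw [Finset.union_empty]
      exact inf_le_right.trans (le_iSup (levelOpen f c) A)
    | insert b B hb ih =>
      intro A
      calc _ ≤ (C ⊓ ((A.inf fun i => (f i).gt c) ⊓ (⨆ j ∉ A ∪ insert b B, (f j).gt c)ᶜ)) ⊓
            ((f b).gt c ⊔ ((f b).gt c)ᶜ) := le_inf le_rfl (inf_le_left.trans (hC b))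
        _ ≤ _ := by
          rw [inf_sup_left]
          refine sup_le (le_trans ?_ (ih (insert b A))) (le_trans ?_ (ih A))
          · rw [Finset.inf_insert, Finset.insert_union, Finset.union_insert]
            refine le_inf (inf_le_left.trans inf_le_left) (le_inf (le_inf inf_le_right ?_) ?_)
            · exact inf_le_left.trans (inf_le_right.trans inf_le_left)
            · exact inf_le_left.trans (inf_le_right.trans inf_le_right)
          · refine le_inf (inf_le_left.trans inf_le_left) (le_inf ?_ ?_)
            · exact inf_le_left.trans (inf_le_right.trans inf_le_left)
            · refine (inf_le_inf (inf_le_right.trans inf_le_right) le_rfl).trans ?_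
              rw [← compl_sup]
              refine compl_le_compl (iSup₂_le fun j hj => ?_)
              by_cases hjb : j = b
              · exact hjb ▸ le_sup_right
              · refine le_sup_of_le_left (le_iSup₂_of_le (f := fun j _ => (f j).gt c) j ?_ le_rfl)
                simpa [hjb] using hj
  rw [← inf_top_eq C, ← hf.iSup_compl_gt hc, inf_iSup_eq]
  exact iSup_le fun F => by simpa using key F ∅

end Partitions

/-! ### From the members of a numerable cover to the whole locale -/

section StripLocal

open TopologicalSpace

variable {L : Type w} [Order.Frame L] {ι : Type w} {f : ι → NNFunction L} {P : L → Prop}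

/-- The function `x ↦ max (δ - |x - c|) 0`. -/
def tent (c δ : ℝ) : C(ℝ≥0, ℝ≥0) where
  toFun x := (δ - |(x : ℝ) - c|).toNNReal

lemma lt_tent_iff {c δ q : ℝ} (hq : 0 ≤ q) (x : ℝ≥0) :
    q < (tent c δ x : ℝ≥0) ↔ |(x : ℝ) - c| < δ - q := by
  change q < max _ _ ↔ _
  rw [lt_max_iff, or_iff_left (not_lt.2 hq)]
  constructor <;> intro h <;> linarith

/-- The open interval `(a, b)` as an open subset of `[0,∞)`. -/
def interval (a b : ℝ) : Opens ℝ≥0 :=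
  ⟨{x : ℝ≥0 | a < (x : ℝ) ∧ (x : ℝ) < b}, (isOpen_lt continuous_const NNReal.continuous_coe).inter
    (isOpen_lt NNReal.continuous_coe continuous_const)⟩

lemma IsPositivePartition.isScale_tent (hf : IsPositivePartition f) {c δ : ℝ} (hδ : 0 ≤ δ)
    (hδ1 : δ ≤ 1) (hδc : δ ≤ c) :
    IsScale fun t => ⨆ i, ((f i).postcomp (tent c δ)).gt t := by
  refine hf.isScale_iSup _ ?_ fun x => ?_
  · refine Real.toNNReal_of_nonpos ?_
    rw [NNReal.coe_zero, zero_sub, abs_neg, abs_of_nonneg (hδ.trans hδc)]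
    linarith
  · refine Real.toNNReal_le_one.2 ?_
    linarith [abs_nonneg ((x : ℝ) - c)]

/-- On this open no `f i` takes values within `δ/2` of `c`, so each `{f i > c}` is complemented
there and the level opens form a disjoint cover. -/
lemma IsStripLocal.inf_lt_of_tent (hP : IsStripLocal P) (hf : IsPositivePartition f)
    (hV : ∀ i, P ((f i).gt 0)) {ρ : ℝ} {a : L} (ha : a ≤ ⨆ i, (f i).gt ρ) {c δ : ℝ}
    (hδ : 0 < δ) (hδ1 : δ ≤ 1) (hδc : δ ≤ c) (hcρ : c ≤ ρ) :
    P (a ⊓ (hf.isScale_tent hδ.le hδ1 hδc).toNNFunction.lt (δ / 2)) := by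
  have hc : 0 < c := hδ.trans_le hδc
  set C := (hf.isScale_tent hδ.le hδ1 hδc).toNNFunction.lt (δ / 2)
  have hC : C ≤ (⨆ i, ((f i).postcomp (tent c δ)).gt (δ / 2))ᶜ :=
    IsScale.toNNFunction_lt_le _ _
  have hle : C ≤ ⨆ F, levelOpen f c F := by
    refine hf.le_iSup_levelOpen hc fun i => ?_
    have hcov : (⊤ : L) ≤ ((f i).gt c ⊔ (f i).lt c) ⊔ ((f i).postcomp (tent c δ)).gt (δ / 2) := by
      change ⊤ ≤ ((f i) _ ⊔ (f i) _) ⊔ (f i) _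
      rw [← map_sup, ← map_sup, ← map_top (f i)]
      refine (f i).mono fun x _ => ?_
      rcases lt_trichotomy c x with h | h | h
      · exact Or.inl (Or.inl h)
      · refine Or.inr ((lt_tent_iff (half_pos hδ).le x).2 ?_)
        rw [← h, sub_self, abs_zero]
        linarith
      · exact Or.inl (Or.inr h)
    calc C ≤ C ⊓ (((f i).gt c ⊔ (f i).lt c) ⊔ ((f i).postcomp (tent c δ)).gt (δ / 2)) :=
          le_inf le_rfl (le_top.trans hcov)
      _ ≤ _ := by
          rw [inf_sup_left]
          refine sup_le (inf_le_right.trans (sup_le_sup le_rfl ?_)) ?_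
          · exact le_compl_iff_disjoint_left.2 (disjoint_iff_inf_le.2 ((f i).gt_inf_lt le_rfl))
          · refine le_trans ?_ (bot_le (a := (f i).gt c ⊔ ((f i).gt c)ᶜ))
            refine (inf_le_inf hC (le_iSup
              (fun i => ((f i).postcomp (tent c δ)).gt (δ / 2)) i)).trans ?_
            exact (compl_inf_self _).le
  refine hP.mono (inf_le_inf le_rfl hle) ?_
  rw [inf_iSup_eq]
  refine hP.iSup _ (fun F F' h => (levelOpen_disjoint c h).mono inf_le_right inf_le_right) ?_
  intro F
  rcases F.eq_empty_or_nonempty with rfl | ⟨i, hi⟩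
  -- For `F = ∅` no `f i` exceeds `c`, whereas over `a` some `f i` exceeds `ρ ≥ c`.
  · refine hP.of_le_bot ?_
    have : a ≤ ⨆ j ∉ (∅ : Finset ι), (f j).gt c := ha.trans (iSup_mono fun i => by
      simpa using (f i).gt_anti hcρ)
    exact (inf_le_inf this inf_le_right).trans (inf_compl_self _).le
  · exact hP.mono (inf_le_right.trans (inf_le_left.trans ((Finset.inf_le hi).trans
      ((f i).gt_anti hc.le)))) (hV i)

lemma inf_iSup_interval_le (f : ι → NNFunction L) (b δ : ℝ) (hδ : 0 ≤ δ) (k : ℕ) :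
    ((Finset.range k).inf fun j => ⨆ i, f i (interval (b + 2 * j * δ) (b + 2 * (j + 1) * δ))) ≤
      ⨆ (F : Finset ι) (_ : F.card = k), F.inf fun i => f i (interval b (b + 2 * k * δ)) := by
  classical
  induction k with
  | zero => exact le_iSup₂_of_le ∅ rfl le_top
  | succ k ih =>
    rw [Finset.range_add_one, Finset.inf_insert]
    refine (inf_le_inf le_rfl ih).trans ?_
    simp only [iSup_inf_eq, inf_iSup_eq]
    refine iSup₂_le fun F hF => iSup_le fun i => ?_
    have hk : b + 2 * k * δ ≤ b + 2 * (k + 1 : ℕ) * δ := by push_cast; nlinarith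
    have hkb : b ≤ b + 2 * k * δ := by
      have : 0 ≤ 2 * (k : ℝ) * δ := by positivity
      linarith
    -- An index already used has its value below the next interval, so the new index is distinct.
    by_cases hi : i ∈ F
    · refine le_trans ((inf_le_inf le_rfl (Finset.inf_le hi)).trans ((f i).inf_le_bot ?_)) bot_le
      exact fun x hx hx' => lt_asymm hx.1 hx'.2
    · refine le_iSup₂_of_le (insert i F) (by rw [Finset.card_insert_of_notMem hi, hF]) ?_
      rw [Finset.inf_insert]
      refine inf_le_inf ((f i).mono fun x hx => ⟨hkb.trans_lt hx.1, ?_⟩)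
        (Finset.inf_mono_fun fun j _ => (f j).mono fun x hx => ⟨hx.1, hx.2.trans_le hk⟩)
      push_cast
      exact hx.2

lemma IsStripLocal.of_le_lt_of_le_gt (hP : IsStripLocal P) (hf : IsPositivePartition f)
    (hV : ∀ i, P ((f i).gt 0)) {s : NNFunction L} (hs : ∀ q, s.gt q = sumGt f q) {n : ℕ} {ρ : ℝ}
    (hρ : 0 < ρ) {a : L} (has : a ≤ s.lt n) (haρ : a ≤ ⨆ i, (f i).gt ρ) : P a := by
  -- `N` values above `ρ/2` add up to more than `n`; `δ` is so small that `N` consecutive intervals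
  -- of length `2δ` fit between `ρ/2` and `ρ`.
  obtain ⟨N, hN⟩ := exists_nat_gt (n / (ρ / 2))
  have hN' : (n : ℝ) < N * (ρ / 2) := (div_lt_iff₀ (half_pos hρ)).1 hN
  have hN0 : (0 : ℝ) < N := lt_of_le_of_lt (by positivity) hN
  set δ : ℝ := min 1 (ρ / 2 / (2 * N))
  have hδ : 0 < δ := lt_min one_pos (by positivity)
  have hδ1 : δ ≤ 1 := min_le_left _ _
  have hδN : 2 * N * δ ≤ ρ / 2 := by
    have : δ ≤ ρ / 2 / (2 * N) := min_le_right _ _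
    rw [le_div_iff₀ (by positivity)] at this
    linarith
  let E : ℕ → L := fun j => ⨆ i, f i (interval (ρ / 2 + 2 * j * δ) (ρ / 2 + 2 * (j + 1) * δ))
  -- Here `k` intervals are known to be hit and `m` remain; each step splits by whether the next
  -- interval is hit.
  have key : ∀ m k, k + m = N → P (a ⊓ (Finset.range k).inf E) := by
    intro m
    induction m with
    | zero =>
      intro k hk
      obtain rfl : k = N := hk
      refine hP.of_le_bot ((inf_le_inf has (inf_iSup_interval_le f _ δ hδ.le k)).trans ?_)
      simp only [inf_iSup_eq]
      refine iSup₂_le fun F hF => le_trans ?_ (s.gt_inf_lt (le_refl (n : ℝ)))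
      rw [inf_comm, hs]
      refine inf_le_inf (le_trans ?_ (inf_gt_le_sumGt (F := F) (r := fun _ => ρ / 2) ?_)) le_rfl
      · exact Finset.inf_mono_fun fun i _ => (f i).mono fun x hx => hx.1
      · simpa [hF] using hN'
    | succ m ih =>
      intro k hk
      have hkN : ((k + 1 : ℕ) : ℝ) ≤ N := Nat.cast_le.2 (by omega)
      push_cast at hkN
      have h2k : 2 * (k + 1) * δ ≤ ρ / 2 := by nlinarith
      have hk0 : 0 ≤ 2 * (k : ℝ) * δ := by positivity
      have hc : δ ≤ ρ / 2 + (2 * k + 1) * δ := by nlinarith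
      have hcρ : ρ / 2 + (2 * k + 1) * δ ≤ ρ := by nlinarith
      refine hP.split (hf.isScale_tent hδ.le hδ1 hc).toNNFunction (half_pos hδ)
        (hP.inf_lt_of_tent hf hV (inf_le_left.trans haρ) hδ hδ1 hc hcρ) ?_
      refine hP.mono ?_ (ih (k + 1) (by omega))
      rw [Finset.range_add_one, Finset.inf_insert, inf_assoc, inf_comm (E k)]
      refine inf_le_inf le_rfl (inf_le_inf le_rfl ?_)
      rw [IsScale.toNNFunction_gt _ le_rfl]
      refine iSup_mono fun i => (f i).mono fun x hx => ?_
      have := abs_lt.1 ((lt_tent_iff le_rfl x).1 hx)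
      constructor
      · linarith [this.1]
      · linarith [this.2]
  simpa using key N 0 (Nat.zero_add N)

/-- A property of opens that is local for the simple covers and holds for the members of a
numerable cover holds for the whole locale. -/
theorem IsStripLocal.top (hP : IsStripLocal P) (hf : IsPositivePartition f)
    (hV : ∀ i, P ((f i).gt 0)) : P ⊤ := by
  obtain ⟨s, hs0, hs⟩ := id hf
  -- Truncation at `1` makes the supremum a bounded scale; bounding its reciprocal by `k` yields `ρ
  -- = 1/k`.
  have hm := hf.isScale_iSup ⟨fun x => min x 1, by fun_prop⟩ (by simp) fun x => min_le_right x 1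
  have hm0 : hm.toNNFunction.gt 0 = ⊤ := by
    rw [hm.toNNFunction_gt le_rfl, eq_top_iff, ← hf.iSup_gt_zero]
    refine iSup_mono fun i => (f i).mono fun x hx => ?_
    exact NNReal.coe_pos.2 (lt_min (NNReal.coe_pos.1 hx) one_pos)
  refine hP.of_lt_nat s fun n => hP.of_lt_nat (hm.toNNFunction.inv hm0) fun k => ?_
  rcases Nat.eq_zero_or_pos k with rfl | hk
  · refine hP.of_le_bot (inf_le_right.trans ?_)
    rw [← map_bot (hm.toNNFunction.inv hm0)]
    refine NNFunction.mono _ fun x hx => ?_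
    exact absurd (show (x : ℝ) < (0 : ℕ) from hx) (by simp)
  · have hk' : (0 : ℝ) < k := Nat.cast_pos.2 hk
    refine hP.of_le_lt_of_le_gt hf hV hs (inv_pos.2 hk') (inf_le_left.trans inf_le_right)
      (inf_le_right.trans ((NNFunction.inv_lt_le _ hm0 hk').trans ?_))
    rw [hm.toNNFunction_gt (inv_pos.2 hk').le]
    refine iSup_mono fun i => (f i).mono fun x hx => ?_
    exact lt_of_lt_of_le hx (NNReal.coe_le_coe.2 (min_le_left x 1))

end StripLocal

/-! ### Pullback and examples of numerable covers -/

section NumerableCovers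

open TopologicalSpace

variable {L M : Type w} [Order.Frame L] [Order.Frame M] {ι : Type w}

lemma map_sumGt (θ : FrameHom L M) (f : ι → NNFunction L) (q : ℝ) :
    θ (sumGt f q) = sumGt (fun i => θ.comp (f i)) q := by
  simp only [sumGt, map_iSup]
  refine iSup_congr fun F => iSup_congr fun r => iSup_congr fun _ => ?_
  exact map_finset_inf θ F _

lemma IsPositivePartition.map (θ : FrameHom L M) {f : ι → NNFunction L}
    (hf : IsPositivePartition f) : IsPositivePartition fun i => θ.comp (f i) := by
  obtain ⟨s, h0, hs⟩ := hf
  refine ⟨θ.comp s, ?_, fun q => ?_⟩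
  · rw [← map_top θ, ← h0]
    rfl
  · rw [← map_sumGt, ← hs]
    rfl

lemma IsNumerableCover.map (θ : FrameHom L M) {V : ι → L} (hV : IsNumerableCover V) :
    IsNumerableCover fun i => θ (V i) := by
  obtain ⟨h, f, hf, hfV⟩ := hV
  refine ⟨by rw [← map_iSup, h, map_top], _, hf.map θ, fun i => ?_⟩
  exact OrderHomClass.mono θ (hfV i)

/-- A summable family of continuous functions with strictly positive continuous sum on a
topological space `T` yields a positive partition on every locale over `T`. -/
lemma isPositivePartition_of_hasSum {T : Type*} [TopologicalSpace T] (θ : FrameHom (Opens T) L)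
    (φ : ι → C(T, ℝ≥0)) (s : C(T, ℝ≥0)) (hs : ∀ x, HasSum (fun i => φ i x) (s x))
    (hpos : ∀ x, 0 < s x) : IsPositivePartition fun i => θ.comp (Opens.comap (φ i)) := by
  refine ⟨θ.comp (Opens.comap s), ?_, fun q => ?_⟩
  · rw [← map_top θ]
    exact congrArg θ (Opens.ext (Set.eq_univ_of_forall fun x => NNReal.coe_pos.2 (hpos x)))
  · have hsR : ∀ x, HasSum (fun i => (φ i x : ℝ)) (s x : ℝ) := fun x => NNReal.hasSum_coe.2 (hs x)
    simp only [sumGt]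
    have hinf : ∀ (F : Finset ι) (r : ι → ℝ),
        (F.inf fun i => NNFunction.gt (θ.comp (Opens.comap (φ i))) (r i)) =
          θ (F.inf fun i => Opens.comap (φ i)
            ⟨{x : ℝ≥0 | r i < (x : ℝ)}, isOpen_lt continuous_const NNReal.continuous_coe⟩) :=
      fun F r => (map_finset_inf θ F _).symm
    simp only [hinf, ← map_iSup]
    refine congrArg θ (Opens.ext (Set.ext fun x => ?_))
    simp only [SetLike.mem_coe, Opens.mem_iSup]
    have hmem : ∀ (F : Finset ι) (r : ι → ℝ), (x ∈ F.inf fun i => Opens.comap (φ i)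
            ⟨{x : ℝ≥0 | r i < (x : ℝ)}, isOpen_lt continuous_const NNReal.continuous_coe⟩) ↔
          ∀ i ∈ F, r i < (φ i x : ℝ) := by
      intro F r
      rw [← SetLike.mem_coe, Opens.coe_finset_inf, Finset.inf_eq_iInf]
      simp
    simp only [hmem]
    constructor
    · intro hq
      obtain ⟨F, hF⟩ := ((hsR x).eventually (lt_mem_nhds (show q < (s x : ℝ) from hq))).exists
      have hd : 0 < ∑ i ∈ F, (φ i x : ℝ) - q := sub_pos.2 hF
      -- The excess over `q` is shared among `F.card + 1` parts, so some of it is left after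
      -- lowering every term.
      refine ⟨F, fun i => φ i x - (∑ i ∈ F, (φ i x : ℝ) - q) / (F.card + 1), ?_, fun i _ => ?_⟩
      · rw [Finset.sum_sub_distrib, Finset.sum_const, nsmul_eq_mul]
        have : (F.card : ℝ) * ((∑ i ∈ F, (φ i x : ℝ) - q) / (F.card + 1)) <
            ∑ i ∈ F, (φ i x : ℝ) - q := by
          rw [mul_div_assoc', div_lt_iff₀ (by positivity)]
          nlinarith
        linarith
      · have : 0 < (∑ i ∈ F, (φ i x : ℝ) - q) / (F.card + 1) := by positivity
        linarith
    · rintro ⟨F, r, hr, hF⟩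
      calc q < ∑ i ∈ F, r i := hr
        _ ≤ ∑ i ∈ F, (φ i x : ℝ) := Finset.sum_le_sum fun i hi => (hF i hi).le
        _ ≤ s x := sum_le_hasSum F (fun i _ => NNReal.coe_nonneg _) (hsR x)

lemma IsNumerableCover.of_lt_gt (g : NNFunction L) {p q : ℝ} (hpq : p < q) :
    IsNumerableCover fun k : ULift.{w} (Fin 2) => ![g.lt q, g.gt p] k.down := by
  let φ : Fin 2 → C(ℝ≥0, ℝ≥0) :=
    ![⟨fun x => (q - x).toNNReal, by fun_prop⟩, ⟨fun x => (x - p).toNNReal, by fun_prop⟩]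
  refine ⟨top_le_iff.1 ((g.lt_sup_gt hpq).ge.trans (sup_le ?_ ?_)), _,
    isPositivePartition_of_hasSum g (fun k : ULift.{w} (Fin 2) => φ k.down) (φ 0 + φ 1)
      (fun x => ?_) fun x => ?_, ?_⟩
  · exact le_iSup (fun k : ULift.{w} (Fin 2) => ![g.lt q, g.gt p] k.down) ⟨0⟩
  · exact le_iSup (fun k : ULift.{w} (Fin 2) => ![g.lt q, g.gt p] k.down) ⟨1⟩
  · rw [← Equiv.ulift.symm.hasSum_iff]
    have h := hasSum_fintype (fun k : Fin 2 => φ k x)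
    rw [Fin.sum_univ_two] at h
    exact h
  · change 0 < (q - x).toNNReal + (x - p).toNNReal
    rcases lt_or_ge (x : ℝ) q with h | h
    · exact add_pos_of_pos_of_nonneg (Real.toNNReal_pos.2 (by linarith)) zero_le
    · exact add_pos_of_nonneg_of_pos zero_le (Real.toNNReal_pos.2 (by linarith))
  · rintro ⟨k⟩
    fin_cases k
    · refine g.mono fun x hx => ?_
      have h : 0 < (q - x).toNNReal := NNReal.coe_pos.1 hx
      exact sub_pos.1 (Real.toNNReal_pos.1 h)
    · refine g.mono fun x hx => ?_
      have h : 0 < ((x : ℝ) - p).toNNReal := NNReal.coe_pos.1 hx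
      exact sub_pos.1 (Real.toNNReal_pos.1 h)

/-- A cover by pairwise disjoint opens, as a map to a discrete space. -/
def discreteFrameHom {κ : Type w} [TopologicalSpace κ] (a : κ → L)
    (ha : Pairwise fun i j => Disjoint (a i) (a j)) (h : ⨆ k, a k = ⊤) :
    FrameHom (Opens κ) L where
  toFun O := ⨆ k ∈ O, a k
  map_inf' O O' := by
    refine le_antisymm (le_inf ?_ ?_) ?_
    · exact iSup₂_le fun k hk => le_iSup₂_of_le k hk.1 le_rfl
    · exact iSup₂_le fun k hk => le_iSup₂_of_le k hk.2 le_rfl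
    · simp only [iSup_inf_eq, inf_iSup_eq]
      refine iSup₂_le fun j hj => iSup₂_le fun k hk => ?_
      by_cases hjk : j = k
      · subst hjk
        exact inf_le_left.trans (le_iSup₂_of_le (f := fun k (_ : k ∈ O ⊓ O') => a k) j
          (by first | exact ⟨hj, hk⟩ | exact ⟨hk, hj⟩) le_rfl)
      · first
        | exact (ha hjk).le_bot.trans bot_le
        | exact (ha (Ne.symm hjk)).le_bot.trans bot_le
  map_top' := by simpa using h
  map_sSup' s := by
    rw [sSup_image]
    refine le_antisymm (iSup₂_le fun k hk => ?_)
      (iSup₂_le fun O hO => iSup₂_le fun k hk => ?_)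
    · obtain ⟨O, hO, hkO⟩ := Opens.mem_sSup.1 hk
      exact le_iSup₂_of_le O hO (le_iSup₂_of_le k hkO le_rfl)
    · exact le_iSup₂_of_le k (Opens.mem_sSup.2 ⟨O, hO, hk⟩) le_rfl

lemma IsNumerableCover.of_disjoint {κ : Type w} (a : κ → L)
    (ha : Pairwise fun i j => Disjoint (a i) (a j)) (h : ⨆ k, a k = ⊤) : IsNumerableCover a := by
  classical
  let _ : TopologicalSpace κ := ⊥
  have _ : DiscreteTopology κ := ⟨rfl⟩
  refine ⟨h, _, isPositivePartition_of_hasSum (discreteFrameHom a ha h)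
    (fun k => ⟨fun j => if k = j then 1 else 0, continuous_of_discreteTopology⟩) 1
    (fun j => hasSum_ite_eq j 1) (fun _ => one_pos), fun k => iSup₂_le fun j hj => ?_⟩
  have h0 : (0 : ℝ) < ((if k = j then 1 else 0 : ℝ≥0) : ℝ) := hj
  by_cases hkj : k = j
  · exact hkj ▸ le_rfl
  · simp [hkj] at h0

end NumerableCovers

/-! ### Inverse images and factorization through open sublocales -/

section LocaleMaps

/-- The inverse image homomorphism of a map of locales. -/
def pull {Y X : Locale.{w}} (f : Y ⟶ X) : FrameHom X Y :=
  Frm.Hom.hom (Quiver.Hom.unop f)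

variable {X Y Z : Locale.{w}}

lemma pull_comp (f : X ⟶ Y) (g : Y ⟶ Z) (a : Z) : pull (f ≫ g) a = pull f (pull g a) := rfl

lemma pull_id (a : X) : pull (𝟙 X) a = a := rfl

lemma pull_openInclusion_eq_top {a b : X} (h : a ≤ b) : pull (openInclusion X a) b = ⊤ :=
  Subtype.ext (inf_eq_right.2 h)

lemma pull_injective {f g : X ⟶ Y} (h : ∀ a, pull f a = pull g a) : f = g :=
  Quiver.Hom.unop_inj (Frm.ext h)

lemma pull_openInclusion_coe {a : X} (b : Set.Iic a) : pull (openInclusion X a) b.1 = b :=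
  Subtype.ext (inf_eq_left.2 b.2)

instance mono_openInclusion (a : X) : Mono (openInclusion X a) where
  right_cancellation k k' h := pull_injective fun b => by
    have := congrArg (fun t => pull t b.1) h
    exact (congrArg (pull k) (pull_openInclusion_coe b)).symm.trans
      (this.trans (congrArg (pull k') (pull_openInclusion_coe b)))

lemma exists_comp_openInclusion_iff (f : Y ⟶ X) (a : X) :
    (∃ k : Y ⟶ openSublocale X a, k ≫ openInclusion X a = f) ↔ pull f a = ⊤ := by
  constructor
  · rintro ⟨k, rfl⟩
    rw [pull_comp, pull_openInclusion_eq_top le_rfl, map_top]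
  · intro h
    let k : FrameHom (Set.Iic a) Y :=
      { toFun := fun b => pull f b.1
        map_inf' := fun b c => map_inf (pull f) b.1 c.1
        map_top' := h
        map_sSup' := fun s => by
          rw [Set.Iic.coe_sSup, map_sSup, Set.image_image] }
    refine ⟨(Frm.ofHom k).op, pull_injective fun b => ?_⟩
    change pull f (b ⊓ a) = pull f b
    rw [map_inf, h, inf_top_eq]

end LocaleMaps

/-! ### Cartesian lifts of opens and the covering families they form -/

section Lifts

variable {S : Type u} [Category.{v} S] {J : GrothendieckTopology S} {U : S ⥤ Locale.{w}}

/-- A cartesian lift of the inclusion of the open sublocale `a`. -/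
structure OpenLift (U : S ⥤ Locale.{w}) {Z : S} (a : U.obj Z) where
  /-- The domain of the lift. -/
  obj : S
  /-- The lifted inclusion. -/
  hom : obj ⟶ Z
  /-- The comparison of the domain with the open sublocale. -/
  iso : U.obj obj ≅ openSublocale (U.obj Z) a
  fac : iso.hom ≫ openInclusion (U.obj Z) a = U.map hom
  exists_comp_eq : ∀ {W : S} (f : W ⟶ Z), pull (U.map f) a = ⊤ → ∃ f' : W ⟶ obj, f' ≫ hom = f

lemma IsNumerableSite.nonempty_openLift (hS : IsNumerableSite J U) {Z : S} (a : U.obj Z) :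
    Nonempty (OpenLift U a) := by
  obtain ⟨Y, g, e, he, hg⟩ := hS.exists_lift Z _ (openInclusion (U.obj Z) a)
    ⟨a, Iso.refl _, Category.id_comp _⟩
  refine ⟨⟨Y, g, e, he, fun {W} f hf => ?_⟩⟩
  obtain ⟨k, hk⟩ := (exists_comp_openInclusion_iff _ _).2 hf
  obtain ⟨χ, ⟨-, hχ⟩, -⟩ := Functor.IsStronglyCartesian.universal_property U (U.map g) g
    (k ≫ e.inv) (U.map f) (by rw [← he, Category.assoc, e.inv_hom_id_assoc, hk]) f
  exact ⟨χ, hχ⟩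

/-- A chosen cartesian lift of the inclusion of an open sublocale. -/
noncomputable def IsNumerableSite.openLift (hS : IsNumerableSite J U) {Z : S} (a : U.obj Z) :
    OpenLift U a :=
  (hS.nonempty_openLift a).some

variable {Z : S} {a : U.obj Z}

lemma OpenLift.pull_hom (l : OpenLift U a) : pull (U.map l.hom) a = ⊤ :=
  (exists_comp_openInclusion_iff _ _).1 ⟨_, l.fac⟩

lemma OpenLift.exists_comp_map_eq (l : OpenLift U a) {Y : Locale.{w}} (f : Y ⟶ U.obj Z)
    (hf : pull f a = ⊤) : ∃ k, k ≫ U.map l.hom = f := by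
  obtain ⟨k, hk⟩ := (exists_comp_openInclusion_iff _ _).2 hf
  exact ⟨k ≫ l.iso.inv, by rw [← l.fac, Category.assoc, l.iso.inv_hom_id_assoc, hk]⟩

lemma OpenLift.mono_map (l : OpenLift U a) : Mono (U.map l.hom) := by
  rw [← l.fac]
  infer_instance

lemma OpenLift.exists_pull_eq (l : OpenLift U a) (b : U.obj l.obj) :
    ∃ b' ≤ a, pull (U.map l.hom) b' = b := by
  let c : Set.Iic a := pull l.iso.inv b
  refine ⟨c.1, c.2, ?_⟩
  rw [← l.fac, pull_comp, pull_openInclusion_coe, ← pull_comp, l.iso.hom_inv_id, pull_id]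

/-- The sieve of all morphisms that factor, on underlying locales, through one of the given
opens. -/
def openSieve (U : S ⥤ Locale.{w}) {Z : S} {κ : Type*} (V : κ → U.obj Z) : Sieve Z where
  arrows _ f := ∃ k, pull (U.map f) (V k) = ⊤
  downward_closed := by
    rintro W W' f ⟨k, hk⟩ g
    exact ⟨k, by rw [U.map_comp, pull_comp, hk, map_top]⟩

/-- The generated sieve ignores repetitions, so the family can be reindexed by its set of morphisms,
which lives in the universe required by `creates`. -/
lemma IsNumerableSite.isCoveringFamily_iff (hS : IsNumerableSite J U) {κ : Type*} (D : κ → S)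
    (f : ∀ i, D i ⟶ Z) :
    IsCoveringFamily numerableTopology (fun i => U.obj (D i)) (fun i => U.map (f i)) ↔
      IsCoveringFamily J D f := by
  let T : Type (max u v) := {p : Σ W : S, W ⟶ Z // ∃ i, p = ⟨D i, f i⟩}
  have h := hS.creates Z T (fun t => t.1.1) (fun t => t.1.2)
  have h1 : Presieve.ofArrows D f = Presieve.ofArrows (fun t : T => t.1.1) (fun t => t.1.2) := by
    refine le_antisymm ?_ ?_
    · rintro W g ⟨i⟩
      exact Presieve.ofArrows.mk (Y := fun t : T => t.1.1) (f := fun t => t.1.2)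
        ⟨⟨D i, f i⟩, i, rfl⟩
    · rintro W g ⟨⟨_, i, rfl⟩⟩
      exact Presieve.ofArrows.mk i
  have h2 : Presieve.ofArrows (fun i => U.obj (D i)) (fun i => U.map (f i)) =
      Presieve.ofArrows (fun t : T => U.obj t.1.1) (fun t => U.map t.1.2) := by
    refine le_antisymm ?_ ?_
    · rintro W g ⟨i⟩
      exact Presieve.ofArrows.mk (Y := fun t : T => U.obj t.1.1) (f := fun t => U.map t.1.2)
        ⟨⟨D i, f i⟩, i, rfl⟩
    · rintro W g ⟨⟨_, i, rfl⟩⟩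
      exact Presieve.ofArrows.mk (Y := fun i => U.obj (D i)) (f := fun i => U.map (f i)) i
  unfold IsCoveringFamily at h ⊢
  rw [h1, h2]
  exact h

lemma IsNumerableCover.isCoveringFamily (hS : IsNumerableSite J U) {κ : Type w}
    {V : κ → U.obj Z} (hV : IsNumerableCover V) :
    IsCoveringFamily J (fun k => (hS.openLift (V k)).obj) (fun k => (hS.openLift (V k)).hom) := by
  rw [← hS.isCoveringFamily_iff]
  refine GrothendieckTopology.superset_covering _ ?_
    (Precoverage.generate_mem_toGrothendieck (J := numerableCovers) ⟨κ, V, hV, rfl⟩)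
  rw [Sieve.generate_le_iff]
  rintro W g ⟨k⟩
  exact ⟨_, (hS.openLift (V k)).iso.inv, _, Presieve.ofArrows.mk
    (Y := fun k => U.obj (hS.openLift (V k)).obj) (f := fun k => U.map (hS.openLift (V k)).hom) k,
    by rw [← (hS.openLift (V k)).fac, Iso.inv_hom_id_assoc]⟩

lemma openSieve_mem_of_disjoint (hS : IsNumerableSite J U) {κ : Type w} {V : κ → U.obj Z}
    (hd : Pairwise fun i j => Disjoint (V i) (V j)) (hV : ⨆ k, V k = ⊤) :
    openSieve U V ∈ (twoElementOrDisjointCovers J U).toGrothendieck Z := by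
  refine GrothendieckTopology.superset_covering _ ?_
    (Precoverage.generate_mem_toGrothendieck (Or.inr ⟨κ, _, _,
      (IsNumerableCover.of_disjoint V hd hV).isCoveringFamily hS,
      ⟨V, hd, fun k => ⟨_, (hS.openLift (V k)).fac⟩⟩, rfl⟩))
  rw [Sieve.generate_le_iff]
  rintro W g ⟨k⟩
  exact ⟨k, (hS.openLift (V k)).pull_hom⟩

lemma openSieve_mem_of_two (hS : IsNumerableSite J U) {V : Fin 2 → U.obj Z}
    (hV : IsNumerableCover fun k : ULift.{w} (Fin 2) => V k.down) :
    openSieve U V ∈ (twoElementOrDisjointCovers J U).toGrothendieck Z := by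
  have hJ : IsCoveringFamily J (fun k => (hS.openLift (V k)).obj)
      (fun k => (hS.openLift (V k)).hom) := by
    refine GrothendieckTopology.superset_covering _ ?_ (hV.isCoveringFamily hS)
    rw [Sieve.generate_le_iff]
    rintro W g ⟨k⟩
    exact Sieve.le_generate _ _ _ (Presieve.ofArrows.mk (Y := fun k => (hS.openLift (V k)).obj)
      (f := fun k => (hS.openLift (V k)).hom) k.down)
  refine GrothendieckTopology.superset_covering _ ?_
    (Precoverage.generate_mem_toGrothendieck (Or.inl ⟨_, _, hJ, rfl⟩))
  rw [Sieve.generate_le_iff]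
  rintro W g ⟨k⟩
  exact ⟨k, (hS.openLift (V k)).pull_hom⟩

end Lifts

/-! ### Comparison of the two topologies -/

section Generation

variable {S : Type u} [Category.{v} S] {J : GrothendieckTopology S} {U : S ⥤ Locale.{w}}

/-- The property of an open of `U.obj Z` that a sieve on `Z` is covering over this open, for the
topology `K`. -/
def CoversOn (U : S ⥤ Locale.{w}) (K : GrothendieckTopology S) {Z : S} (R : Sieve Z)
    (a : U.obj Z) : Prop :=
  ∀ ⦃W : S⦄ (g : W ⟶ Z), pull (U.map g) a = ⊤ → R.pullback g ∈ K W

lemma CoversOn.of_openSieve_mem {K : GrothendieckTopology S} {Z : S} {R : Sieve Z} {a : U.obj Z}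
    {κ : Type*} {b : κ → U.obj Z} (hb : ∀ k, CoversOn U K R (b k))
    (h : ∀ ⦃W : S⦄ (g : W ⟶ Z), pull (U.map g) a = ⊤ →
      openSieve U (fun k => pull (U.map g) (b k)) ∈ K W) : CoversOn U K R a := by
  intro W g hg
  refine K.transitive (h g hg) _ ?_
  rintro W' f ⟨k, hk⟩
  rw [← Sieve.pullback_comp]
  refine hb k _ ?_
  rw [U.map_comp, pull_comp]
  exact hk

lemma isStripLocal_coversOn (hS : IsNumerableSite J U) {Z : S} (R : Sieve Z) :
    IsStripLocal (CoversOn U (twoElementOrDisjointCovers J U).toGrothendieck R) where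
  mono hab hb W g hg := hb g (top_le_iff.1 (hg.ge.trans (OrderHomClass.mono (pull (U.map g)) hab)))
  iSup a ha h := CoversOn.of_openSieve_mem h fun W g hg =>
    openSieve_mem_of_disjoint hS
      (fun i j hij => (ha hij).map (pull (U.map g))) (by rw [← map_iSup, hg])
  split {a} f p q hpq h1 h2 := by
    refine CoversOn.of_openSieve_mem (b := ![a ⊓ f.lt q, a ⊓ f.gt p]) (fun k => ?_) fun W g hg => ?_
    · fin_cases k
      · exact h1
      · exact h2
    -- The inverse image of `a` under `g` is `⊤`, so intersecting with `a` has no effect on `W`.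
    · have hc := IsNumerableCover.of_lt_gt ((pull (U.map g)).comp f) hpq
      refine GrothendieckTopology.superset_covering _ ?_ (openSieve_mem_of_two hS hc)
      rintro W' t ⟨k, hk⟩
      refine ⟨k, ?_⟩
      rw [← hk]
      congr 1
      fin_cases k
      · exact (map_inf (pull (U.map g)) a (f.lt q)).trans (by rw [hg, top_inf_eq]; rfl)
      · exact (map_inf (pull (U.map g)) a (f.gt p)).trans (by rw [hg, top_inf_eq]; rfl)

/-- Numerable open covers of underlying locales are covering in the topology generated by
two-element and disjoint covering families. -/
lemma openSieve_mem (hS : IsNumerableSite J U) {Z : S} {ι : Type w} {V : ι → U.obj Z}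
    (hV : IsNumerableCover V) :
    openSieve U V ∈ (twoElementOrDisjointCovers J U).toGrothendieck Z := by
  obtain ⟨-, f, hf, hfV⟩ := hV
  have h := (isStripLocal_coversOn hS (openSieve U V)).top hf (fun i W g hg => ?_) (𝟙 Z)
    (map_top _)
  · rwa [Sieve.pullback_id] at h
  · rw [(Sieve.mem_iff_pullback_eq_top (S := openSieve U V) g).1
      ⟨i, top_le_iff.1 (hg.ge.trans (OrderHomClass.mono (pull (U.map g)) (hfV i)))⟩]
    exact GrothendieckTopology.top_mem _ _

/-- The sieve of all morphisms that factor, on underlying locales, through an open `a` such that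
the map `a → U.obj Z → Y` belongs to the sieve `R`. -/
def locallyInSieve (U : S ⥤ Locale.{w}) {Z : S} {Y : Locale.{w}} (φ : U.obj Z ⟶ Y)
    (R : Sieve Y) : Sieve Z :=
  openSieve U fun a : {a : U.obj Z // R (openInclusion (U.obj Z) a ≫ φ)} => a.1

/-- The topology on locales consisting of the sieves which pull back, along every map from the
underlying locale of an object of the site, to a sieve containing an open cover that is covering
for `K`. -/
def inducedLocaleTopology (hS : IsNumerableSite J U) (K : GrothendieckTopology S) :
    GrothendieckTopology Locale.{w} where
  sieves Y := {R | ∀ (Z : S) (φ : U.obj Z ⟶ Y), locallyInSieve U φ R ∈ K Z}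
  top_mem' Y Z φ := by
    refine K.superset_covering ?_ (K.top_mem Z)
    exact fun W f _ => ⟨⟨⊤, trivial⟩, map_top _⟩
  pullback_stable' Y Y' R f hR Z φ := by
    refine K.superset_covering ?_ (hR Z (φ ≫ f))
    rintro W g ⟨⟨a, ha⟩, hg⟩
    refine ⟨⟨a, ?_⟩, hg⟩
    simpa using ha
  transitive' Y R hR R' hR' Z φ := by
    refine K.transitive (hR Z φ) _ ?_
    rintro W f ⟨⟨a, ha⟩, hf⟩
    let l := hS.openLift a
    obtain ⟨f', rfl⟩ := l.exists_comp_eq f hf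
    rw [Sieve.pullback_comp]
    refine K.pullback_stable f' (K.superset_covering ?_ (hR' ha l.obj l.iso.hom))
    rintro W' g ⟨⟨b, hb⟩, hg⟩
    obtain ⟨b', hb'a, rfl⟩ := l.exists_pull_eq b
    refine ⟨⟨b', ?_⟩, ?_⟩
    -- The inclusion of `b'` into `U.obj Z` factors through the open `b` of the lift of `a`, so
    -- membership in `R'` passes from `b` to `b'`.
    · obtain ⟨k, hk⟩ := l.exists_comp_map_eq (openInclusion _ b') (pull_openInclusion_eq_top hb'a)
      obtain ⟨k', rfl⟩ := (exists_comp_openInclusion_iff k (pull (U.map l.hom) b')).2 (by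
        rw [← pull_comp, hk, pull_openInclusion_eq_top le_rfl])
      have hb2 := R'.downward_closed hb k'
      have he : k' ≫ openInclusion (U.obj l.obj) (pull (U.map l.hom) b') ≫ l.iso.hom ≫
          openInclusion (U.obj Z) a ≫ φ = openInclusion (U.obj Z) b' ≫ φ := by
        rw [← hk, ← Category.assoc l.iso.hom, l.fac]
        simp only [Category.assoc]
      rw [← he]
      simpa using hb2
    · rw [U.map_comp, pull_comp]
      exact hg

lemma numerableTopology_le (hS : IsNumerableSite J U) :
    numerableTopology ≤
      inducedLocaleTopology hS (twoElementOrDisjointCovers J U).toGrothendieck := by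
  refine Precoverage.toGrothendieck_le_iff_le_toPrecoverage.2 ?_
  rintro Y _ ⟨ι, V, hV, rfl⟩ Z φ
  refine GrothendieckTopology.superset_covering _ ?_ (openSieve_mem hS (hV.map (pull φ)))
  rintro W f ⟨i, hf⟩
  refine ⟨⟨pull φ (V i), ?_⟩, hf⟩
  obtain ⟨k, hk⟩ := (exists_comp_openInclusion_iff (openInclusion _ (pull φ (V i)) ≫ φ) (V i)).2
    (by rw [pull_comp, pull_openInclusion_eq_top le_rfl])
  exact ⟨_, k, _, Presieve.ofArrows.mk i, hk⟩

/-- A split epimorphism of locales generates the maximal sieve. The section need not lift to `S`;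
since `U` creates covering families, repeating `u` gives a two-element cover. -/
lemma generate_singleton_mem (hS : IsNumerableSite J U) {W Z : S} (u : W ⟶ Z)
    (σ : U.obj Z ⟶ U.obj W) (hσ : σ ≫ U.map u = 𝟙 _) :
    Sieve.generate (Presieve.ofArrows (fun _ : Fin 2 => W) fun _ => u) ∈
      (twoElementOrDisjointCovers J U).toGrothendieck Z := by
  refine Precoverage.generate_mem_toGrothendieck (Or.inl ⟨_, _, ?_, rfl⟩)
  rw [← hS.isCoveringFamily_iff]
  refine GrothendieckTopology.superset_covering _ (Sieve.id_mem_iff_eq_top.1 ?_).ge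
    (GrothendieckTopology.top_mem _ _)
  exact ⟨_, σ, _, Presieve.ofArrows.mk (0 : Fin 2), hσ⟩

lemma le_toGrothendieck (hS : IsNumerableSite J U) :
    J ≤ (twoElementOrDisjointCovers J U).toGrothendieck := by
  intro X R hR
  let T := Σ W : S, {f : W ⟶ X // R f}
  have hT : IsCoveringFamily J (fun t : T => t.1) (fun t => t.2.1) := by
    refine J.superset_covering (fun W f hf => ?_) hR
    exact Sieve.le_generate _ _ _ (Presieve.ofArrows.mk (⟨W, f, hf⟩ : T))
  have hU := numerableTopology_le hS _ ((hS.isCoveringFamily_iff _ _).2 hT) X (𝟙 _)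
  refine GrothendieckTopology.transitive _ hU _ ?_
  rintro W f ⟨⟨a, ha⟩, hf⟩
  let l := hS.openLift a
  obtain ⟨f', rfl⟩ := l.exists_comp_eq f hf
  rw [Sieve.pullback_comp]
  refine GrothendieckTopology.pullback_stable _ f' ?_
  rw [Category.comp_id] at ha
  obtain ⟨_, k, _, ⟨⟨Y, r, hr⟩⟩, hk⟩ := ha
  dsimp only at k hk
  -- The map `k` factors the inclusion of `a` through `U.map r`. Restricting `r` over `a` gives `t :
  -- m.obj ⟶ l.obj`, and `k` becomes a section `σ` of `U.map t`.
  let m := hS.openLift (pull (U.map r) a)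
  obtain ⟨t, ht⟩ := l.exists_comp_eq (m.hom ≫ r) (by rw [U.map_comp, pull_comp, m.pull_hom])
  obtain ⟨σ, hσ⟩ := m.exists_comp_map_eq (l.iso.hom ≫ k) (by
    rw [← pull_comp, Category.assoc, hk, l.fac, l.pull_hom])
  refine GrothendieckTopology.superset_covering _ ?_ (generate_singleton_mem hS t σ ?_)
  · rw [Sieve.generate_le_iff]
    rintro W g ⟨_⟩
    change R (t ≫ l.hom)
    rw [ht]
    exact R.downward_closed hr _
  · have := l.mono_map
    rw [← cancel_mono (U.map l.hom), Category.assoc, ← U.map_comp, ht, U.map_comp, ← Category.assoc,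
      hσ, Category.assoc, hk, l.fac, Category.id_comp]

lemma toGrothendieck_le (J : GrothendieckTopology S) (U : S ⥤ Locale.{w}) :
    (twoElementOrDisjointCovers J U).toGrothendieck ≤ J := by
  refine Precoverage.toGrothendieck_le_iff_le_toPrecoverage.2 ?_
  rintro X _ (⟨Y, f, hf, rfl⟩ | ⟨ι, Y, f, hf, -, rfl⟩)
  · exact hf
  · exact hf

end Generation

end NumerableSites

theorem mainTheorem10 {S : Type u} [Category.{v} S] (J : GrothendieckTopology S)
    (U : S ⥤ Locale.{w}) (hS : NumerableSites.IsNumerableSite J U) :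
    J = (NumerableSites.twoElementOrDisjointCovers J U).toGrothendieck :=
  le_antisymm (NumerableSites.le_toGrothendieck hS) (NumerableSites.toGrothendieck_le J U)
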